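/- Let $V$ be a complex nuclear space, i.e. a locally convex space such that for every continuous seminorm $p$ on $V$ there is a continuous seminorm $q\ge p$ for which the canonical map $\widehat V_q\to\widehat V_p$ between the completions of $V/\ker q$ and $V/\ker p$ is a nuclear operator. Let $\mathcal T^\bullet_{\mathrm{alg}}(V)=\bigoplus_{k\ge 0}V^{\otimes k}$, write $\langle X\rangle_k$ for the degree-$k$ component of $X$, and let $\mathcal S^\bullet(V)\subseteq\mathcal T^\bullet_{\mathrm{alg}}(V)$ be the subspace of symmetric tensors (the image of the symmetrisation operator). For a continuous positive (semidefinite) Hermitian form $\langle\cdot,\cdot\rangle_\alpha$ on $V$ let $\|v\|_\alpha=\sqrt{\langle v,v\rangle_\alpha}$ be its Hilbert seminorm, and let $\|X\|_\alpha^\bullet=\sqrt{\langle X,X\rangle_\alpha^\bullet}$, where $\langle\cdot,\cdot\rangle^\bullet_\alpha$ is the sesquilinear form on $\mathcal T^\bullet_{\mathrm{alg}}(V)$ for which different degrees are orthogonal and $$\langle x_1\otimes\cdots\otimes x_k,\,y_1\otimes\cdots\otimes y_k\rangle_\alpha^\bullet=k!\prod_{m=1}^k\langle x_m,y_m\rangle_\alpha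 .$$ For $R\in\mathbb R$ and a continuous seminorm $p$ on $V$ let $$p_R(X)=\sum_{k=0}^\infty (k!)^R\,p^{\otimes k}(\langle X\rangle_k),\qquad p^{\otimes k}(Y)=\inf\sum_{i}|c_i|\prod_{m=1}^k p(x_{i,m}),$$ the infimum being taken over all expressions $Y=\sum_i c_i\,x_{i,1}\otimes\cdots\otimes x_{i,k}$ as a finite sum with $c_i\in\mathbb C$ and $x_{i,m}\in V$ (so $p^{\otimes 0}$ is the absolute value on $V^{\otimes 0}=\mathbb C$). Then the locally convex topology on $\mathcal S^\bullet(V)$ defined by the (restrictions of the) seminorms $\|\cdot\|_\alpha^\bullet$ of all continuous positive Hermitian forms $\langle\cdot,\cdot\rangle_\alpha$ on $V$ coincides with the topology constructed by Waldmann (2014) for $R=\frac12$, i.e. with the locally convex topology defined by the (restrictions of the) seminorms $p_{1/2}$ of all continuous seminorms $p$ on $V$; equivalently, by the seminorms $p_{1/2}$ for all continuous Hilbert seminorms $p=\|\cdot\|_\alpha$ on $V$. -/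

import Mathlib

open scoped TensorProduct DirectSum ComplexConjugate

noncomputable section

namespace NuclearWeyl

/-! ### Nuclear spaces -/

section Nuclear

/-- A continuous linear map `T : E → F` between normed spaces is nuclear if
`T x = ∑ₙ fₙ(x) yₙ` for continuous linear functionals `fₙ` on `E` and vectors `yₙ` of `F` with
`∑ₙ ‖fₙ‖ ‖yₙ‖ < ∞`. -/
def IsNuclearMap {E F : Type*} [NormedAddCommGroup E] [NormedSpace ℂ E]
    [NormedAddCommGroup F] [NormedSpace ℂ F] (T : E →L[ℂ] F) : Prop :=
  ∃ (f : ℕ → E →L[ℂ] ℂ) (y : ℕ → F), Summable (fun n => ‖f n‖ * ‖y n‖) ∧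
    ∀ x, HasSum (fun n => f n x • y n) (T x)

variable {V : Type*} [AddCommGroup V] [Module ℂ V]

/-- The vector space `V`, viewed as a seminormed space with the seminorm `p`. -/
def SeminormSpace (_p : Seminorm ℂ V) : Type _ := V

instance (p : Seminorm ℂ V) : SeminormedAddCommGroup (SeminormSpace p) :=
  p.toSeminormedAddCommGroup

instance (p : Seminorm ℂ V) : Module ℂ (SeminormSpace p) := inferInstanceAs (Module ℂ V)

instance (p : Seminorm ℂ V) : NormedSpace ℂ (SeminormSpace p) where
  norm_smul_le c x := (map_smul_eq_mul p c x).le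

/-- The local Banach space of a seminorm `p` on `V`: the (Hausdorff) completion of `(V, p)`,
i.e. the completion of the normed space `V / ker p`. -/
abbrev LocalBanachSpace (p : Seminorm ℂ V) : Type _ :=
  UniformSpace.Completion (SeminormSpace p)

/-- The identity of `V` as a continuous linear map `(V, q) → (V, p)`, for `p ≤ q`. -/
def seminormSpaceMap {p q : Seminorm ℂ V} (h : p ≤ q) :
    SeminormSpace q →L[ℂ] SeminormSpace p :=
  LinearMap.mkContinuous
    ({ toFun := fun x => x, map_add' := fun _ _ => rfl, map_smul' := fun _ _ => rfl } :
      SeminormSpace q →ₗ[ℂ] SeminormSpace p) 1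
    (fun x => by rw [one_mul]; exact h x)

/-- The canonical map between the local Banach spaces of two seminorms `p ≤ q`. -/
def localBanachMap {p q : Seminorm ℂ V} (h : p ≤ q) :
    LocalBanachSpace q →L[ℂ] LocalBanachSpace p :=
  (seminormSpaceMap h).completion

variable (V) in
/-- A locally convex space (a topological vector space whose topology is given by its continuous
seminorms) is nuclear if for every continuous seminorm `p` there is a continuous seminorm `q ≥ p`
such that the canonical map from the local Banach space of `q` to the one of `p` is nuclear. -/
structure IsNuclearSpace [TopologicalSpace V] : Prop where
  locallyConvex : PolynormableSpace ℂ V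
  exists_nuclear : ∀ p : Seminorm ℂ V, Continuous p →
    ∃ (q : Seminorm ℂ V) (h : p ≤ q), Continuous q ∧ IsNuclearMap (localBanachMap h)

end Nuclear

/-! ### Positive Hermitian forms and Hilbert seminorms -/

/-- A positive Hermitian form on a complex vector space: antilinear in the first argument, linear
in the second, Hermitian and positive semidefinite. -/
structure PosHermForm (E : Type*) [AddCommGroup E] [Module ℂ E] where
  form : E →ₗ⋆[ℂ] E →ₗ[ℂ] ℂ
  conj_symm : ∀ x y, conj (form x y) = form y x
  nonneg : ∀ x, 0 ≤ (form x x).re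

namespace PosHermForm

variable {E : Type*} [AddCommGroup E] [Module ℂ E]

abbrev core (B : PosHermForm E) : PreInnerProductSpace.Core ℂ E where
  inner x y := B.form x y
  conj_inner_symm x y := B.conj_symm y x
  re_inner_nonneg x := B.nonneg x
  add_left x y z := by simp
  smul_left x y r := by simp

/-- The Hilbert seminorm `v ↦ √⟨v, v⟩` of a positive Hermitian form. -/
def seminorm (B : PosHermForm E) : Seminorm ℂ E :=
  Seminorm.of (fun x => √(B.form x x).re)
    (fun x y => by
      let := InnerProductSpace.Core.toSeminormedAddCommGroup (c := B.core)
      exact norm_add_le x y)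
    (fun c x => by
      let := InnerProductSpace.Core.toSeminormedAddCommGroup (c := B.core)
      let : NormedSpace ℂ E := InnerProductSpace.Core.toNormedSpace (c := B.core)
      exact norm_smul c x)

theorem seminorm_apply (B : PosHermForm E) (x : E) : B.seminorm x = √(B.form x x).re := rfl


/-- For `y ∈ Vᵏ`, the antilinear functional on `V^{⊗k}` with
`x₁ ⊗ ⋯ ⊗ xₖ ↦ ∏ₘ ⟨xₘ, yₘ⟩`. -/
def powerAux (B : PosHermForm E) (k : ℕ) (y : Fin k → E) : (⨂[ℂ]^k E) →ₗ⋆[ℂ] ℂ :=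
  (starLinearEquiv ℂ : ℂ ≃ₗ⋆[ℂ] ℂ).toLinearMap.comp
    (PiTensorProduct.lift
      ((MultilinearMap.mkPiAlgebra ℂ (Fin k) ℂ).compLinearMap fun m => B.form (y m)))

theorem powerAux_tprod (B : PosHermForm E) (k : ℕ) (x y : Fin k → E) :
    B.powerAux k y (PiTensorProduct.tprod ℂ x) = ∏ m, B.form (x m) (y m) := by
  simp only [powerAux, LinearMap.comp_apply, PiTensorProduct.lift.tprod,
    MultilinearMap.compLinearMap_apply, MultilinearMap.mkPiAlgebra_apply]
  change conj (∏ m, B.form (y m) (x m)) = _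
  simp only [map_prod, B.conj_symm]

theorem antilinear_ext {k : ℕ} {f g : (⨂[ℂ]^k E) →ₗ⋆[ℂ] ℂ}
    (h : ∀ x : Fin k → E, f (PiTensorProduct.tprod ℂ x) = g (PiTensorProduct.tprod ℂ x)) :
    f = g := by
  ext X
  induction X using PiTensorProduct.induction_on with
  | smul_tprod r x => rw [map_smulₛₗ, map_smulₛₗ, h]
  | add a b ha hb => rw [map_add, map_add, ha, hb]

/-- The map `powerAux` as a multilinear map. -/
def powerAuxMultilinear (B : PosHermForm E) (k : ℕ) :
    MultilinearMap ℂ (fun _ : Fin k => E) ((⨂[ℂ]^k E) →ₗ⋆[ℂ] ℂ) where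
  toFun := B.powerAux k
  map_update_add' {_} y i a b := antilinear_ext fun x => by
    rw [LinearMap.add_apply, powerAux_tprod, powerAux_tprod, powerAux_tprod]
    have := ((MultilinearMap.mkPiAlgebra ℂ (Fin k) ℂ).compLinearMap
      fun m => B.form (x m)).map_update_add y i a b
    simpa only [MultilinearMap.compLinearMap_apply, MultilinearMap.mkPiAlgebra_apply] using this
  map_update_smul' {_} y i c a := antilinear_ext fun x => by
    rw [LinearMap.smul_apply, powerAux_tprod, powerAux_tprod]
    have := ((MultilinearMap.mkPiAlgebra ℂ (Fin k) ℂ).compLinearMap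
      fun m => B.form (x m)).map_update_smul y i c a
    simpa only [MultilinearMap.compLinearMap_apply, MultilinearMap.mkPiAlgebra_apply] using this

/-- The sesquilinear form on `V^{⊗k}` with
`⟨x₁ ⊗ ⋯ ⊗ xₖ, y₁ ⊗ ⋯ ⊗ yₖ⟩ = ∏ₘ ⟨xₘ, yₘ⟩` (see `powerForm_tprod`). -/
def powerForm (B : PosHermForm E) (k : ℕ) : (⨂[ℂ]^k E) →ₗ⋆[ℂ] (⨂[ℂ]^k E) →ₗ[ℂ] ℂ :=
  (PiTensorProduct.lift (B.powerAuxMultilinear k)).flip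

theorem powerForm_tprod (B : PosHermForm E) (k : ℕ) (x y : Fin k → E) :
    B.powerForm k (PiTensorProduct.tprod ℂ x) (PiTensorProduct.tprod ℂ y) =
      ∏ m, B.form (x m) (y m) := by
  rw [powerForm, LinearMap.flip_apply, PiTensorProduct.lift.tprod]
  exact B.powerAux_tprod k x y

theorem exists_sum_tprod {k : ℕ} (X : ⨂[ℂ]^k E) :
    ∃ (n : ℕ) (c : Fin n → ℂ) (x : Fin n → Fin k → E),
      X = ∑ i, c i • PiTensorProduct.tprod ℂ (x i) := by
  induction X using PiTensorProduct.induction_on with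
  | smul_tprod r x => exact ⟨1, fun _ => r, fun _ => x, by simp⟩
  | add a b ha hb =>
    obtain ⟨n, c, x, rfl⟩ := ha
    obtain ⟨m, d, y, rfl⟩ := hb
    exact ⟨n + m, Fin.append c d, Fin.append x y, by simp [Fin.sum_univ_add]⟩

theorem powerForm_conj_symm (B : PosHermForm E) (k : ℕ) (X Y : ⨂[ℂ]^k E) :
    conj (B.powerForm k X Y) = B.powerForm k Y X := by
  obtain ⟨n, c, x, rfl⟩ := exists_sum_tprod X
  obtain ⟨m, d, y, rfl⟩ := exists_sum_tprod Y
  simp only [map_sum, LinearMap.sum_apply, map_smul, map_smulₛₗ, LinearMap.smul_apply,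
    powerForm_tprod, smul_eq_mul, map_mul, map_prod, B.conj_symm]
  simp only [Finset.mul_sum]
  rw [Finset.sum_comm]
  refine Finset.sum_congr rfl fun i _ => Finset.sum_congr rfl fun j _ => ?_
  rw [Complex.conj_conj]
  ring

open scoped ComplexOrder in
theorem gram_posSemidef (B : PosHermForm E) {n : ℕ} (x : Fin n → E) :
    (Matrix.of fun i j => B.form (x i) (x j)).PosSemidef := by
  rw [Matrix.posSemidef_iff_dotProduct_mulVec]
  refine ⟨Matrix.ext fun i j => by simp [Matrix.conjTranspose_apply, B.conj_symm], fun c => ?_⟩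
  have h : star c ⬝ᵥ ((Matrix.of fun i j => B.form (x i) (x j)).mulVec c) =
      B.form (∑ i, c i • x i) (∑ i, c i • x i) := by
    simp only [dotProduct, Matrix.mulVec, Finset.mul_sum, map_sum, LinearMap.sum_apply, map_smul,
      map_smulₛₗ, LinearMap.smul_apply, smul_eq_mul, Matrix.of_apply, Pi.star_apply]
    refine Finset.sum_comm.trans
      (Finset.sum_congr rfl fun i _ => Finset.sum_congr rfl fun j _ => ?_)
    simp only [RCLike.star_def]
    ring
  rw [h, Complex.le_def]
  refine ⟨B.nonneg _, ?_⟩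
  have := congrArg Complex.im (B.conj_symm (∑ i, c i • x i) (∑ i, c i • x i))
  simp only [Complex.conj_im] at this
  simp only [Complex.zero_im]
  linarith

open scoped ComplexOrder in
theorem gram_prod_posSemidef (B : PosHermForm E) {n k : ℕ} (x : Fin n → Fin k → E) :
    (Matrix.of fun i j => ∏ m, B.form (x i m) (x j m)).PosSemidef := by
  induction k with
  | zero =>
    have := Matrix.posSemidef_vecMulVec_self_star (fun _ : Fin n => (1 : ℂ))
    convert this using 1
    ext i j
    simp [Matrix.vecMulVec]
  | succ k ih =>
    have := (B.gram_posSemidef fun i => x i 0).hadamard (ih fun i m => x i m.succ)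
    have h : (Matrix.of fun i j => ∏ m, B.form (x i m) (x j m)) =
        (Matrix.of fun i j => B.form (x i 0) (x j 0)).hadamard
          (Matrix.of fun i j => ∏ m, B.form (x i (Fin.succ m)) (x j (Fin.succ m))) := by
      ext i j
      simp [Fin.prod_univ_succ]
    rw [h]
    exact this

open scoped ComplexOrder in
theorem powerForm_nonneg (B : PosHermForm E) (k : ℕ) (X : ⨂[ℂ]^k E) :
    0 ≤ (B.powerForm k X X).re := by
  obtain ⟨n, c, x, rfl⟩ := exists_sum_tprod X
  have := (Complex.le_def.1 ((B.gram_prod_posSemidef x).dotProduct_mulVec_nonneg c)).1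
  refine this.trans_eq (congrArg Complex.re ?_)
  simp only [dotProduct, Matrix.mulVec, Finset.mul_sum, map_sum, LinearMap.sum_apply, map_smul,
    map_smulₛₗ, LinearMap.smul_apply, smul_eq_mul, Matrix.of_apply, Pi.star_apply,
    powerForm_tprod]
  refine Finset.sum_comm.trans
    (Finset.sum_congr rfl fun i _ => Finset.sum_congr rfl fun j _ => ?_)
  simp only [RCLike.star_def]
  ring

end PosHermForm

/-! ### The tensor algebra and its symmetric part -/

section Tensors

variable (V : Type*) [AddCommGroup V] [Module ℂ V]

/-- The vector space underlying the tensor algebra, `⨁ₖ V^{⊗k}`. -/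
abbrev Tens : Type _ := ⨁ k : ℕ, ⨂[ℂ]^k V

/-- The symmetrisation operator in degree `k`: it maps `x₁ ⊗ ⋯ ⊗ xₖ` to
`1/k! ∑_σ x_{σ(1)} ⊗ ⋯ ⊗ x_{σ(k)}` (see `symmetrizeDegree_tprod`). -/
def symmetrizeDegree (k : ℕ) : (⨂[ℂ]^k V) →ₗ[ℂ] ⨂[ℂ]^k V :=
  ((k.factorial : ℂ)⁻¹) •
    ∑ σ : Equiv.Perm (Fin k), (PiTensorProduct.reindex ℂ (fun _ => V) σ.symm).toLinearMap

theorem symmetrizeDegree_tprod (k : ℕ) (x : Fin k → V) :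
    symmetrizeDegree V k (PiTensorProduct.tprod ℂ x) =
      ((k.factorial : ℂ)⁻¹) •
        ∑ σ : Equiv.Perm (Fin k), PiTensorProduct.tprod ℂ (fun m => x (σ m)) := by
  simp [symmetrizeDegree]

/-- The symmetrisation operator on `⨁ₖ V^{⊗k}`. -/
def symmetrize : Tens V →ₗ[ℂ] Tens V := DirectSum.lmap (symmetrizeDegree V)

/-- The symmetric tensors in `⨁ₖ V^{⊗k}`, i.e. the image of the symmetrisation operator. -/
def SymTens : Submodule ℂ (Tens V) := LinearMap.range (symmetrize V)

end Tensors

/-! ### Extension of Hilbert seminorms to the tensor algebra -/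

namespace PosHermForm

variable {V : Type*} [AddCommGroup V] [Module ℂ V]

theorem finite_support_tens (B : PosHermForm V) (X Y : Tens V) :
    (Function.support fun k => (k.factorial : ℂ) * B.powerForm k (X k) (Y k)).Finite := by
  refine (DFinsupp.finite_support X).subset fun k hk hX => hk ?_
  change X k = 0 at hX
  simp [hX]

/-- The extension of a positive Hermitian form from `V` to `⨁ₖ V^{⊗k}`: different degrees are
orthogonal and
`⟨x₁ ⊗ ⋯ ⊗ xₖ, y₁ ⊗ ⋯ ⊗ yₖ⟩ = k! ∏ₘ ⟨xₘ, yₘ⟩`. -/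
def tens (B : PosHermForm V) : PosHermForm (Tens V) where
  form := LinearMap.mk₂'ₛₗ _ _
    (fun X Y => ∑ᶠ k : ℕ, (k.factorial : ℂ) * B.powerForm k (X k) (Y k))
    (fun X X' Y => by
      rw [← finsum_add_distrib (B.finite_support_tens X Y) (B.finite_support_tens X' Y)]
      exact finsum_congr fun k => by simp [mul_add])
    (fun c X Y => by
      rw [smul_finsum]
      exact finsum_congr fun k => by
        simp only [DirectSum.smul_apply, map_smulₛₗ, LinearMap.smul_apply, smul_eq_mul, RingHom.id_apply]
        exact mul_left_comm _ _ _)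
    (fun X Y Y' => by
      rw [← finsum_add_distrib (B.finite_support_tens X Y) (B.finite_support_tens X Y')]
      exact finsum_congr fun k => by simp [mul_add])
    (fun c X Y => by
      rw [smul_finsum]
      exact finsum_congr fun k => by
        simp only [DirectSum.smul_apply, map_smulₛₗ, LinearMap.smul_apply, smul_eq_mul, RingHom.id_apply]
        exact mul_left_comm _ _ _)
  conj_symm X Y := by
    simp only [LinearMap.mk₂'ₛₗ_apply]
    refine ((starRingEnd ℂ).toAddMonoidHom.map_finsum (B.finite_support_tens X Y)).trans ?_
    exact finsum_congr fun k => by simp [powerForm_conj_symm]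
  nonneg X := by
    simp only [LinearMap.mk₂'ₛₗ_apply]
    have h := Complex.reAddGroupHom.map_finsum (B.finite_support_tens X X)
    rw [Complex.coe_reAddGroupHom] at h
    rw [h]
    refine finsum_nonneg fun k => ?_
    have := B.powerForm_nonneg k (X k)
    simp only [Complex.mul_re, Complex.natCast_re, Complex.natCast_im, zero_mul, sub_zero]
    positivity

theorem tens_apply (B : PosHermForm V) (X Y : Tens V) :
    B.tens.form X Y = ∑ᶠ k : ℕ, (k.factorial : ℂ) * B.powerForm k (X k) (Y k) := rfl

end PosHermForm

section HilbertTopology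

variable (V : Type*) [AddCommGroup V] [Module ℂ V] [TopologicalSpace V]

/-- The set of all continuous positive Hermitian forms on `V`. -/
abbrev ContPosHermForm : Type _ :=
  {B : PosHermForm V // Continuous fun v : V × V => B.form v.1 v.2}

/-- The locally convex topology on `⨁ₖ V^{⊗k}` defined by the extensions of all continuous
Hilbert seminorms of `V`. -/
abbrev hilbertTopology : TopologicalSpace (Tens V) :=
  (SeminormFamily.moduleFilterBasis
    (fun B : ContPosHermForm V => B.1.tens.seminorm : SeminormFamily ℂ (Tens V) _)).topology

/-- The topology on the symmetric tensors defined by the extensions of all continuous Hilbert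
seminorms of `V`, i.e. the subspace topology of `hilbertTopology`. -/
abbrev symHilbertTopology : TopologicalSpace (SymTens V) :=
  (hilbertTopology V).induced Subtype.val

end HilbertTopology

/-! ### Projective extension of seminorms to the tensor algebra -/

section Projective

variable {V : Type*} [AddCommGroup V] [Module ℂ V]

/-- The values `∑ᵢ |cᵢ| ∏ₘ p(x_{i,m})` over all expressions of `X` as a finite sum
`∑ᵢ cᵢ x_{i,1} ⊗ ⋯ ⊗ x_{i,k}`. -/
def projectiveValues (p : Seminorm ℂ V) (k : ℕ) (X : ⨂[ℂ]^k V) : Set ℝ :=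
  {r | ∃ (n : ℕ) (c : Fin n → ℂ) (x : Fin n → Fin k → V),
    X = ∑ i, c i • PiTensorProduct.tprod ℂ (x i) ∧ r = ∑ i, ‖c i‖ * ∏ m, p (x i m)}

theorem projectiveValues_nonempty (p : Seminorm ℂ V) (k : ℕ) (X : ⨂[ℂ]^k V) :
    (projectiveValues p k X).Nonempty := by
  obtain ⟨n, c, x, h⟩ := PosHermForm.exists_sum_tprod X
  exact ⟨_, n, c, x, h, rfl⟩

theorem projectiveValues_nonneg {p : Seminorm ℂ V} {k : ℕ} {X : ⨂[ℂ]^k V} {r : ℝ}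
    (h : r ∈ projectiveValues p k X) : 0 ≤ r := by
  obtain ⟨n, c, x, -, rfl⟩ := h
  exact Finset.sum_nonneg fun i _ =>
    mul_nonneg (norm_nonneg _) (Finset.prod_nonneg fun m _ => apply_nonneg p _)

theorem projectiveValues_bddBelow (p : Seminorm ℂ V) (k : ℕ) (X : ⨂[ℂ]^k V) :
    BddBelow (projectiveValues p k X) :=
  ⟨0, fun _ h => projectiveValues_nonneg h⟩

/-- The `k`-th projective tensor power of a seminorm `p`: the infimum of
`∑ᵢ |cᵢ| ∏ₘ p(x_{i,m})` over all expressions of `X` as a finite sum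
`∑ᵢ cᵢ x_{i,1} ⊗ ⋯ ⊗ x_{i,k}`. For `k ≥ 1` the coefficients can be absorbed into the vectors; for
`k = 0` this is the absolute value on `V^{⊗0} = ℂ`. -/
def projectivePower (p : Seminorm ℂ V) (k : ℕ) : Seminorm ℂ (⨂[ℂ]^k V) :=
  Seminorm.ofSMulLE (fun X => sInf (projectiveValues p k X))
    (le_antisymm
      (csInf_le (projectiveValues_bddBelow p k 0) ⟨0, Fin.elim0, Fin.elim0, by simp, by simp⟩)
      (le_csInf (projectiveValues_nonempty p k 0) fun _ h => projectiveValues_nonneg h))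
    (fun X Y => by
      rw [← csInf_add (projectiveValues_nonempty p k X) (projectiveValues_bddBelow p k X)
        (projectiveValues_nonempty p k Y) (projectiveValues_bddBelow p k Y)]
      refine csInf_le_csInf (projectiveValues_bddBelow p k _)
        ((projectiveValues_nonempty p k X).add (projectiveValues_nonempty p k Y)) ?_
      rintro _ ⟨_, ⟨n, c, x, rfl, rfl⟩, _, ⟨m, d, y, rfl, rfl⟩, rfl⟩
      exact ⟨n + m, Fin.append c d, Fin.append x y, by simp [Fin.sum_univ_add],
        by simp [Fin.sum_univ_add]⟩)
    (fun a X => by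
      rw [← smul_eq_mul, ← Real.sInf_smul_of_nonneg (norm_nonneg a)]
      refine csInf_le_csInf (projectiveValues_bddBelow p k _)
        ((projectiveValues_nonempty p k X).smul_set) ?_
      rintro _ ⟨_, ⟨n, c, x, rfl, rfl⟩, rfl⟩
      exact ⟨n, fun i => a * c i, x, by simp [Finset.smul_sum, mul_smul],
        by simp [Finset.mul_sum, mul_assoc]⟩)

theorem projectivePower_apply (p : Seminorm ℂ V) (k : ℕ) (X : ⨂[ℂ]^k V) :
    projectivePower p k X = sInf (projectiveValues p k X) := rfl

theorem finite_support_projective (R : ℝ) (p : Seminorm ℂ V) (X : Tens V) :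
    (Function.support fun k => (k.factorial : ℝ) ^ R * projectivePower p k (X k)).Finite := by
  refine (DFinsupp.finite_support X).subset fun k hk hX => hk ?_
  change X k = 0 at hX
  simp [hX]

/-- The seminorm `X ↦ ∑ₖ (k!)ᴿ p^{⊗k}(Xₖ)` on `⨁ₖ V^{⊗k}`, where `p^{⊗k}` is the projective
tensor power. -/
def projectiveTens (R : ℝ) (p : Seminorm ℂ V) : Seminorm ℂ (Tens V) :=
  Seminorm.of (fun X => ∑ᶠ k : ℕ, (k.factorial : ℝ) ^ R * projectivePower p k (X k))
    (fun X Y => by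
      rw [← finsum_add_distrib (finite_support_projective R p X)
        (finite_support_projective R p Y)]
      refine finsum_le_finsum' (finite_support_projective R p (X + Y))
        ((finite_support_projective R p X).union (finite_support_projective R p Y) |>.subset
          (Function.support_add _ _)) fun k => ?_
      rw [← mul_add]
      exact mul_le_mul_of_nonneg_left (map_add_le_add _ _ _) (by positivity))
    (fun c X => by
      rw [← smul_eq_mul, smul_finsum]
      exact finsum_congr fun k => by
        rw [DirectSum.smul_apply, map_smul_eq_mul, smul_eq_mul]
        exact mul_left_comm _ _ _)

theorem projectiveTens_apply (R : ℝ) (p : Seminorm ℂ V) (X : Tens V) :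
    projectiveTens R p X = ∑ᶠ k : ℕ, (k.factorial : ℝ) ^ R * projectivePower p k (X k) := rfl

/-- The locally convex topology on the symmetric tensors which is defined by the restrictions of
the seminorms `X ↦ ∑ₖ (k!)ᴿ p^{⊗k}(Xₖ)`, where `p` runs through the given set `P` of seminorms
of `V`. -/
abbrev symProjectiveTopologyOf (R : ℝ) (P : Set (Seminorm ℂ V)) : TopologicalSpace (SymTens V) :=
  (SeminormFamily.moduleFilterBasis
    (fun p : P => projectiveTens R p.1 : SeminormFamily ℂ (Tens V) _)).topology.induced
      Subtype.val

variable (V) in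
/-- The projective topology with parameter `R` on the symmetric tensors: the one defined by the
seminorms `X ↦ ∑ₖ (k!)ᴿ p^{⊗k}(Xₖ)` for all continuous seminorms `p` of `V`. -/
abbrev symProjectiveTopology [TopologicalSpace V] (R : ℝ) : TopologicalSpace (SymTens V) :=
  symProjectiveTopologyOf R {p : Seminorm ℂ V | Continuous p}

variable (V) in
/-- The set of all continuous Hilbert seminorms of `V`. -/
def hilbertSeminorms [TopologicalSpace V] : Set (Seminorm ℂ V) :=
  Set.range fun B : ContPosHermForm V => B.1.seminorm

end Projective

end NuclearWeyl

end

noncomputable section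

namespace NuclearWeyl

open Filter Topology

variable {V : Type*} [AddCommGroup V] [Module ℂ V]

/-! ### Expansions along nuclear maps -/

/-! The two families of seminorms dominate each other on all of `⨁ₖ V^{⊗k}`; symmetric tensors enter
only through restriction at the very end.

One direction holds on every locally convex space. The Hilbert tensor seminorm is multiplicative on
elementary tensors, hence at most the projective one (`PosHermForm.power_seminorm_le`), and an `ℓ²`
sum over degrees is at most the `ℓ¹` sum. The weight `k!` inside the square root becomes
`(k!)^{1/2}`, which is why `R = 1/2` (`PosHermForm.tens_seminorm_le`).

The other direction uses nuclearity. Given `p`, choose `q ≥ p` with nuclear canonical map and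
expand, formally, `x = ∑ₙ gₙ(x) zₙ` with `|gₙ| ≤ q`, `p(zₙ) ≤ sₙ` and `C = ∑ sₙ < ∞`. The form `⟨x,
y⟩ = ∑ₙ 4C sₙ conj(gₙ(x)) gₙ(y)` is continuous. Expanding `X ∈ V^{⊗k}` over multi-indices `r` bounds
`p^{⊗k}(X)` by `∑_r |g_r(X)| ∏ₘ s_{rₘ}`. Cauchy–Schwarz with `s = √(s/(4C)) √(4C s)` then gives
`2^{-k}` times the Hilbert seminorm of `X` (`IsNuclearSpace.exists_projectivePower_le`). The gain
`2^{-k}` makes the sum over degrees converge, so `p_{1/2} ≤ 2 ‖·‖^•`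
(`projectiveTens_le_of_projectivePower_le`).

The vectors of the nuclear expansion lie only in the completion, whereas `p^{⊗k}` is defined by
finite sums of tensors over `V`. The expansion is therefore replaced by finite-rank operators on `V`
converging pointwise to the identity, with bounds independent of the stage. -/

/-- If the canonical map `(V, q) → (V, p)` is nuclear, then the identity of `V` is approximated
pointwise for `p` by finite rank operators `x ↦ ∑ₙ gₙ(x) zₙ` with `|gₙ| ≤ q` and
`p(zₙ) ≤ sₙ` for a fixed summable sequence `s`. -/
theorem IsNuclearMap.exists_finite_rank_approx {p q : Seminorm ℂ V} {h : p ≤ q}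
    (hn : IsNuclearMap (localBanachMap h)) :
    ∃ (g : ℕ → V →ₗ[ℂ] ℂ) (s : ℕ → ℝ) (z : ℕ → ℕ → V),
      (∀ n, 0 < s n) ∧ Summable s ∧ (∀ n x, ‖g n x‖ ≤ q x) ∧ (∀ j n, p (z j n) ≤ s n) ∧
      ∀ x, Tendsto (fun j => p (x - ∑ n ∈ Finset.range j, g n x • z j n)) atTop (𝓝 0) := by
  obtain ⟨f, y, hs, hT⟩ := hn
  let ι : V → LocalBanachSpace p := fun x => ((show SeminormSpace p from x) : LocalBanachSpace p)
  let κ : SeminormSpace q →ₗ[ℂ] LocalBanachSpace q :=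
    (UniformSpace.Completion.toComplL (𝕜 := ℂ) (E := SeminormSpace q)).toLinearMap
  have hι : ∀ x, ‖ι x‖ = p x := fun x => UniformSpace.Completion.norm_coe (E := SeminormSpace p) x
  have hκ : ∀ x : V, ‖κ x‖ = q x := fun x =>
    UniformSpace.Completion.norm_coe (E := SeminormSpace q) x
  have ι_sub : ∀ x y, ι (x - y) = ι x - ι y := fun x y =>
    UniformSpace.Completion.coe_sub (α := SeminormSpace p) x y
  have ι_sum : ∀ (j : ℕ) (c : ℕ → ℂ) (v : ℕ → V),
      ι (∑ n ∈ Finset.range j, c n • v n) = ∑ n ∈ Finset.range j, c n • ι (v n) := fun j c v =>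
    (map_sum (UniformSpace.Completion.toComplL (𝕜 := ℂ) (E := SeminormSpace p)) _ _).trans
      (Finset.sum_congr rfl fun n _ =>
        map_smul (UniformSpace.Completion.toComplL (𝕜 := ℂ) (E := SeminormSpace p)) _ _)
  -- Normalising gives `|gₙ| ≤ q` and moves the factor `‖fₙ‖` to the vector. If `fₙ = 0`, the
  -- convention `0⁻¹ = 0` makes `gₙ = 0`, which is harmless.
  let g : ℕ → V →ₗ[ℂ] ℂ := fun n =>
    ((‖f n‖ : ℂ)⁻¹) • ((f n).toLinearMap ∘ₗ κ : SeminormSpace q →ₗ[ℂ] ℂ)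
  have g_apply : ∀ n x, g n x = (‖f n‖ : ℂ)⁻¹ * f n (κ x) := fun n x => rfl
  have hg : ∀ n x, g n x • ((‖f n‖ : ℂ) • y n) = f n (κ x) • y n := by
    intro n x
    by_cases h0 : f n = 0
    · simp [g_apply, h0]
    · have : (‖f n‖ : ℂ) ≠ 0 := by simpa using h0
      rw [smul_smul, g_apply]
      congr 1
      field_simp
  have hgq : ∀ n x, ‖g n x‖ ≤ q x := by
    intro n x
    rw [g_apply, norm_mul, norm_inv, Complex.norm_real, norm_norm]
    by_cases h0 : ‖f n‖ = 0
    · simp [h0]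
    · rw [inv_mul_le_iff₀ (lt_of_le_of_ne (norm_nonneg _) (Ne.symm h0)), ← hκ x]
      exact (f n).le_opNorm _
  -- The factor `2^{-n}` keeps the total error over `n` bounded; the factor `1/(j+1)` makes it
  -- vanish as `j → ∞`.
  have hz : ∀ j n : ℕ, ∃ v : V,
      ‖(‖f n‖ : ℂ) • y n - ι v‖ < (1 / 2 : ℝ) ^ n * (1 / ((j : ℝ) + 1)) := by
    intro j n
    obtain ⟨v, hv⟩ := (UniformSpace.Completion.denseRange_coe (α := SeminormSpace p)).exists_dist_lt
      ((‖f n‖ : ℂ) • y n) (ε := (1 / 2 : ℝ) ^ n * (1 / ((j : ℝ) + 1))) (by positivity)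
    exact ⟨v, by rwa [dist_eq_norm] at hv⟩
  choose z hz using hz
  -- The summand `2^{-n}` absorbs the approximation error for every `j` and makes each `sₙ` strictly
  -- positive.
  refine ⟨g, fun n => ‖f n‖ * ‖y n‖ + (1 / 2 : ℝ) ^ n, z, fun n => by positivity,
    hs.add summable_geometric_two, hgq, fun j n => ?_, fun x => ?_⟩
  · have h1 : ‖ι (z j n)‖ ≤ ‖(‖f n‖ : ℂ) • y n‖ + ‖(‖f n‖ : ℂ) • y n - ι (z j n)‖ := by
      have := norm_sub_le ((‖f n‖ : ℂ) • y n) ((‖f n‖ : ℂ) • y n - ι (z j n))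
      rwa [sub_sub_cancel] at this
    rw [hι, norm_smul, Complex.norm_real, norm_norm] at h1
    have h2 : (1 / 2 : ℝ) ^ n * (1 / ((j : ℝ) + 1)) ≤ (1 / 2 : ℝ) ^ n :=
      mul_le_of_le_one_right (by positivity) (by
        rw [div_le_one (by positivity)]; linarith [(Nat.cast_nonneg j : (0 : ℝ) ≤ j)])
    linarith [(hz j n).le]
  · have hT' : Tendsto (fun j => ‖∑ n ∈ Finset.range j, f n (κ x) • y n - ι x‖) atTop (𝓝 0) := by
      have h1 := (hT (κ x)).tendsto_sum_nat
      have h2 : localBanachMap h (κ x) = ι x :=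
        ContinuousLinearMap.completion_apply_coe (seminormSpaceMap h) x
      rw [h2] at h1
      exact tendsto_iff_norm_sub_tendsto_zero.1 h1
    have hb : Tendsto (fun j : ℕ => 2 * q x * (1 / ((j : ℝ) + 1))) atTop (𝓝 0) := by
      simpa using tendsto_one_div_add_atTop_nhds_zero_nat.const_mul (2 * q x)
    have hlim := hT'.add hb
    rw [add_zero] at hlim
    refine squeeze_zero (fun j => apply_nonneg p _) (fun j => ?_) hlim
    rw [← hι, ι_sub, ι_sum, norm_sub_rev]
    -- Truncation error of the nuclear series, minus the error of replacing its vectors by elements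
    -- of `V`; the latter is at most `2 q(x)/(j+1)`.
    have e : ∑ n ∈ Finset.range j, g n x • ι (z j n) - ι x =
        (∑ n ∈ Finset.range j, f n (κ x) • y n - ι x) -
          ∑ n ∈ Finset.range j, g n x • ((‖f n‖ : ℂ) • y n - ι (z j n)) := by
      simp only [smul_sub, Finset.sum_sub_distrib, hg]
      abel
    rw [e]
    refine (norm_sub_le _ _).trans (add_le_add le_rfl ((norm_sum_le _ _).trans ?_))
    calc ∑ n ∈ Finset.range j, ‖g n x • ((‖f n‖ : ℂ) • y n - ι (z j n))‖
        ≤ ∑ n ∈ Finset.range j, q x * ((1 / 2 : ℝ) ^ n * (1 / ((j : ℝ) + 1))) :=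
          Finset.sum_le_sum fun n _ => by
            rw [norm_smul]
            exact mul_le_mul (hgq n x) (hz j n).le (norm_nonneg _) (apply_nonneg q x)
      _ = q x * (∑ n ∈ Finset.range j, (1 / 2 : ℝ) ^ n) * (1 / ((j : ℝ) + 1)) := by
          rw [Finset.mul_sum, Finset.sum_mul]
          exact Finset.sum_congr rfl fun n _ => by ring
      _ ≤ q x * 2 * (1 / ((j : ℝ) + 1)) := by
          have := apply_nonneg q x
          gcongr
          exact (summable_geometric_two.sum_le_tsum _ fun n _ => by positivity).trans_eq
            tsum_geometric_two
      _ = 2 * q x * (1 / ((j : ℝ) + 1)) := by ring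

/-! ### Hilbert seminorms given by square summable families of functionals -/

theorem summable_mul_conj_mul {g : ℕ → V →ₗ[ℂ] ℂ} {t : ℕ → ℝ} {q : Seminorm ℂ V}
    (ht : Summable t) (h0 : ∀ n, 0 ≤ t n) (hg : ∀ n x, ‖g n x‖ ≤ q x) (x y : V) :
    Summable fun n => (t n : ℂ) * (conj (g n x) * g n y) := by
  refine Summable.of_norm_bounded (ht.mul_right (q x * q y)) fun n => ?_
  rw [norm_mul, norm_mul, RCLike.norm_conj, Complex.norm_real, Real.norm_of_nonneg (h0 n)]
  exact mul_le_mul_of_nonneg_left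
    (mul_le_mul (hg n x) (hg n y) (norm_nonneg _) (apply_nonneg q x)) (h0 n)

/-- The positive Hermitian form `∑ₙ tₙ conj(gₙ(x)) gₙ(y)`. -/
def PosHermForm.ofFunctionals (g : ℕ → V →ₗ[ℂ] ℂ) (t : ℕ → ℝ) (q : Seminorm ℂ V)
    (ht : Summable t) (h0 : ∀ n, 0 ≤ t n) (hg : ∀ n x, ‖g n x‖ ≤ q x) : PosHermForm V where
  form := LinearMap.mk₂'ₛₗ _ _ (fun x y => ∑' n, (t n : ℂ) * (conj (g n x) * g n y))
    (fun x x' y => by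
      rw [← (summable_mul_conj_mul ht h0 hg x y).tsum_add (summable_mul_conj_mul ht h0 hg x' y)]
      exact tsum_congr fun n => by simp only [map_add]; ring)
    (fun c x y => by
      rw [smul_eq_mul, ← tsum_mul_left]
      exact tsum_congr fun n => by simp only [map_smul, smul_eq_mul, map_mul]; ring)
    (fun x y y' => by
      rw [← (summable_mul_conj_mul ht h0 hg x y).tsum_add (summable_mul_conj_mul ht h0 hg x y')]
      exact tsum_congr fun n => by simp only [map_add]; ring)
    (fun c x y => by
      rw [smul_eq_mul, ← tsum_mul_left]
      exact tsum_congr fun n => by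
        simp only [map_smul, smul_eq_mul, RingHom.id_apply]; ring)
  conj_symm x y := by
    simp only [LinearMap.mk₂'ₛₗ_apply]
    rw [Complex.conj_tsum]
    exact tsum_congr fun n => by
      simp only [map_mul, Complex.conj_conj, Complex.conj_ofReal]; ring
  nonneg x := by
    simp only [LinearMap.mk₂'ₛₗ_apply]
    rw [Complex.re_tsum (summable_mul_conj_mul ht h0 hg x x)]
    refine tsum_nonneg fun n => ?_
    rw [← Complex.normSq_eq_conj_mul_self, ← Complex.ofReal_mul, Complex.ofReal_re]
    exact mul_nonneg (h0 n) (Complex.normSq_nonneg _)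

section OfFunctionals

variable {g : ℕ → V →ₗ[ℂ] ℂ} {t : ℕ → ℝ} {q : Seminorm ℂ V}
  (ht : Summable t) (h0 : ∀ n, 0 ≤ t n) (hg : ∀ n x, ‖g n x‖ ≤ q x)

theorem PosHermForm.hasSum_ofFunctionals (x y : V) :
    HasSum (fun n => (t n : ℂ) * (conj (g n x) * g n y))
      ((PosHermForm.ofFunctionals g t q ht h0 hg).form x y) :=
  (summable_mul_conj_mul ht h0 hg x y).hasSum

theorem PosHermForm.norm_ofFunctionals_le (x y : V) :
    ‖(PosHermForm.ofFunctionals g t q ht h0 hg).form x y‖ ≤ (∑' n, t n) * (q x * q y) := by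
  refine (PosHermForm.hasSum_ofFunctionals ht h0 hg x y).norm_le_of_bounded
    (ht.hasSum.mul_right (q x * q y)) fun n => ?_
  rw [norm_mul, norm_mul, RCLike.norm_conj, Complex.norm_real, Real.norm_of_nonneg (h0 n)]
  exact mul_le_mul_of_nonneg_left
    (mul_le_mul (hg n x) (hg n y) (norm_nonneg _) (apply_nonneg q x)) (h0 n)

theorem PosHermForm.continuous_of_norm_le [TopologicalSpace V] [IsTopologicalAddGroup V]
    (B : PosHermForm V) {C : ℝ} (hq : Continuous q)
    (hB : ∀ x y, ‖B.form x y‖ ≤ C * (q x * q y)) :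
    Continuous fun v : V × V => B.form v.1 v.2 := by
  rw [continuous_iff_continuousAt]
  rintro ⟨x₀, y₀⟩
  have key : Tendsto (fun v : V × V => C * (q (v.1 - x₀) * q v.2) + C * (q x₀ * q (v.2 - y₀)))
      (𝓝 (x₀, y₀)) (𝓝 0) := by
    have : Continuous fun v : V × V =>
        C * (q (v.1 - x₀) * q v.2) + C * (q x₀ * q (v.2 - y₀)) := by fun_prop
    simpa using this.tendsto (x₀, y₀)
  refine tendsto_iff_norm_sub_tendsto_zero.2 (squeeze_zero (fun _ => norm_nonneg _) (fun v => ?_) key)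
  have e : B.form v.1 v.2 - B.form x₀ y₀ =
      B.form (v.1 - x₀) v.2 + B.form x₀ (v.2 - y₀) := by
    simp only [map_sub, LinearMap.sub_apply]; ring
  rw [e]
  exact (norm_add_le _ _).trans (add_le_add (hB _ _) (hB _ _))

/-- The functional `x₁ ⊗ ⋯ ⊗ xₖ ↦ ∏ₘ gₘ(xₘ)`. -/
def prodFunctional {k : ℕ} (g : Fin k → V →ₗ[ℂ] ℂ) : (⨂[ℂ]^k V) →ₗ[ℂ] ℂ :=
  PiTensorProduct.lift ((MultilinearMap.mkPiAlgebra ℂ (Fin k) ℂ).compLinearMap g)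

theorem prodFunctional_tprod {k : ℕ} (g : Fin k → V →ₗ[ℂ] ℂ) (x : Fin k → V) :
    prodFunctional g (PiTensorProduct.tprod ℂ x) = ∏ m, g m (x m) := by
  simp [prodFunctional]

open Fintype in
-- On elementary tensors, a product of `k` partial sums is the sum over the box `{0, …, N-1}^k`;
-- sesquilinearity does the rest. Working with boxes avoids summability over multi-indices.
theorem PosHermForm.tendsto_powerForm_ofFunctionals {k : ℕ} (X Y : ⨂[ℂ]^k V) :
    Tendsto (fun N => ∑ r ∈ piFinset fun _ : Fin k => Finset.range N,
      ((∏ m, t (r m) : ℝ) : ℂ) *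
        (conj (prodFunctional (fun m => g (r m)) X) * prodFunctional (fun m => g (r m)) Y))
      atTop (𝓝 ((PosHermForm.ofFunctionals g t q ht h0 hg).powerForm k X Y)) := by
  induction X using PiTensorProduct.induction_on with
  | add a b ha hb =>
    rw [map_add, LinearMap.add_apply]
    refine (ha.add hb).congr fun N => ?_
    rw [← Finset.sum_add_distrib]
    exact Finset.sum_congr rfl fun r _ => by simp only [map_add]; ring
  | smul_tprod c x =>
    rw [map_smulₛₗ, LinearMap.smul_apply, smul_eq_mul]
    suffices h : Tendsto (fun N => ∑ r ∈ piFinset fun _ : Fin k => Finset.range N,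
        ((∏ m, t (r m) : ℝ) : ℂ) *
          (conj (prodFunctional (fun m => g (r m)) (PiTensorProduct.tprod ℂ x)) *
            prodFunctional (fun m => g (r m)) Y)) atTop
        (𝓝 ((PosHermForm.ofFunctionals g t q ht h0 hg).powerForm k
          (PiTensorProduct.tprod ℂ x) Y)) by
      refine (h.const_mul _).congr fun N => ?_
      rw [Finset.mul_sum]
      exact Finset.sum_congr rfl fun r _ => by simp only [map_smul, smul_eq_mul, map_mul]; ring
    induction Y using PiTensorProduct.induction_on with
    | add a b ha hb =>
      rw [map_add]
      refine (ha.add hb).congr fun N => ?_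
      rw [← Finset.sum_add_distrib]
      exact Finset.sum_congr rfl fun r _ => by simp only [map_add]; ring
    | smul_tprod d y =>
      rw [map_smul, smul_eq_mul, powerForm_tprod]
      refine ((tendsto_finsetProd Finset.univ fun m _ =>
        (PosHermForm.hasSum_ofFunctionals ht h0 hg (x m) (y m)).tendsto_sum_nat).const_mul
          d).congr fun N => ?_
      rw [Finset.prod_univ_sum, Finset.mul_sum]
      refine Finset.sum_congr rfl fun r _ => ?_
      simp only [map_smul, smul_eq_mul, prodFunctional_tprod, map_prod, Finset.prod_mul_distrib,
        Complex.ofReal_prod]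
      ring

open Fintype in
-- A Bessel-type inequality: on the diagonal the box sums have nonnegative terms, so they increase
-- to their limit.
theorem PosHermForm.sum_le_powerForm_ofFunctionals {k : ℕ} (X : ⨂[ℂ]^k V) (N : ℕ) :
    ∑ r ∈ piFinset fun _ : Fin k => Finset.range N,
      (∏ m, t (r m)) * ‖prodFunctional (fun m => g (r m)) X‖ ^ 2 ≤
      ((PosHermForm.ofFunctionals g t q ht h0 hg).powerForm k X X).re := by
  have h := (Complex.continuous_re.tendsto _).comp
    (PosHermForm.tendsto_powerForm_ofFunctionals ht h0 hg X X)
  have e : ∀ N, (∑ r ∈ piFinset fun _ : Fin k => Finset.range N,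
      ((∏ m, t (r m) : ℝ) : ℂ) *
        (conj (prodFunctional (fun m => g (r m)) X) * prodFunctional (fun m => g (r m)) X)).re =
      ∑ r ∈ piFinset fun _ : Fin k => Finset.range N,
        (∏ m, t (r m)) * ‖prodFunctional (fun m => g (r m)) X‖ ^ 2 := fun N => by
    rw [Complex.re_sum]
    refine Finset.sum_congr rfl fun r _ => ?_
    rw [← Complex.normSq_eq_conj_mul_self, ← Complex.ofReal_mul, Complex.ofReal_re,
      Complex.normSq_eq_norm_sq]
  refine Monotone.ge_of_tendsto (f := fun N => ∑ r ∈ piFinset fun _ : Fin k => Finset.range N,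
        (∏ m, t (r m)) * ‖prodFunctional (fun m => g (r m)) X‖ ^ 2) (fun M N hMN => ?_)
    (h.congr e) N
  exact Finset.sum_le_sum_of_subset_of_nonneg
    (piFinset_subset _ _ fun _ => Finset.range_subset_range.2 hMN)
    fun r _ _ => mul_nonneg (Finset.prod_nonneg fun m _ => h0 _) (by positivity)

end OfFunctionals

/-! ### Estimates for projective tensor powers -/

/-- Frees the index set from the `Fin n` of the definition, so that sums over multi-indices can be
used directly. -/
theorem projectivePower_sum_tprod_le (p : Seminorm ℂ V) {k : ℕ} {ι : Type*} (s : Finset ι)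
    (c : ι → ℂ) (x : ι → Fin k → V) :
    projectivePower p k (∑ i ∈ s, c i • PiTensorProduct.tprod ℂ (x i)) ≤
      ∑ i ∈ s, ‖c i‖ * ∏ m, p (x i m) := by
  refine csInf_le (projectiveValues_bddBelow p k _)
    ⟨s.card, fun i => c (s.equivFin.symm i), fun i => x (s.equivFin.symm i), ?_, ?_⟩
  · rw [← Finset.sum_coe_sort]
    exact (Equiv.sum_comp s.equivFin.symm
      (fun i : s => c i • PiTensorProduct.tprod ℂ (x i))).symm
  · rw [← Finset.sum_coe_sort]
    exact (Equiv.sum_comp s.equivFin.symm (fun i : s => ‖c i‖ * ∏ m, p (x i m))).symm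

theorem projectivePower_tprod_le (p : Seminorm ℂ V) {k : ℕ} (x : Fin k → V) :
    projectivePower p k (PiTensorProduct.tprod ℂ x) ≤ ∏ m, p (x m) := by
  simpa using projectivePower_sum_tprod_le p {()} (fun _ => 1) (fun _ => x)

/-- Each `⟨y, y⟩` is real by Hermitian symmetry, so taking real parts and square roots commutes with
the product. -/
theorem PosHermForm.powerForm_tprod_self (B : PosHermForm V) {k : ℕ} (x : Fin k → V) :
    √(B.powerForm k (PiTensorProduct.tprod ℂ x) (PiTensorProduct.tprod ℂ x)).re =
      ∏ m, B.seminorm (x m) := by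
  have h : ∀ y, B.form y y = ((B.form y y).re : ℂ) := fun y =>
    (Complex.conj_eq_iff_re.1 (B.conj_symm y y)).symm
  rw [powerForm_tprod, Finset.prod_congr rfl fun m _ => h (x m), ← Complex.ofReal_prod,
    Complex.ofReal_re, Real.sqrt_prod _ fun m _ => B.nonneg _]
  rfl

/-- The positive Hermitian form on `V^{⊗k}` induced by one on `V`. -/
def PosHermForm.power (B : PosHermForm V) (k : ℕ) : PosHermForm (⨂[ℂ]^k V) where
  form := B.powerForm k
  conj_symm := B.powerForm_conj_symm k
  nonneg := B.powerForm_nonneg k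

/-- Any seminorm bounded by `∏ₘ p(xₘ)` on elementary tensors is at most `p^{⊗k}`, by the triangle
inequality applied to each expression of `X`. -/
theorem PosHermForm.power_seminorm_le (B : PosHermForm V) (k : ℕ) (X : ⨂[ℂ]^k V) :
    (B.power k).seminorm X ≤ projectivePower B.seminorm k X := by
  refine le_csInf (projectiveValues_nonempty _ k X) ?_
  rintro _ ⟨n, c, x, rfl, rfl⟩
  refine (Finset.le_sum_of_subadditive (B.power k).seminorm (map_zero _).le
    (map_add_le_add _) _ _).trans (Finset.sum_le_sum fun i _ => ?_)
  rw [map_smul_eq_mul]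
  exact (congrArg _ (B.powerForm_tprod_self (x i))).le

theorem PosHermForm.tens_form_self (B : PosHermForm V) (X : Tens V) :
    (B.tens.form X X).re = ∑ᶠ k : ℕ, (k.factorial : ℝ) * (B.power k).seminorm (X k) ^ 2 := by
  have h := Complex.reAddGroupHom.map_finsum (B.finite_support_tens X X)
  rw [Complex.coe_reAddGroupHom] at h
  rw [tens_apply, h]
  refine finsum_congr fun k => ?_
  rw [seminorm_apply, Real.sq_sqrt ((B.power k).nonneg _)]
  simp [power]

/-- Compare degree by degree and use `∑ aₖ² ≤ (∑ aₖ)²` for `aₖ ≥ 0`, where `aₖ` carries the weight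
`√(k!)`. -/
theorem PosHermForm.tens_seminorm_le (B : PosHermForm V) (X : Tens V) :
    B.tens.seminorm X ≤ projectiveTens (1 / 2) B.seminorm X := by
  have hX : {k | X k ≠ 0}.Finite := DFinsupp.finite_support X
  rw [seminorm_apply, tens_form_self, projectiveTens_apply,
    finsum_eq_sum_of_support_subset (s := hX.toFinset) _ (fun k hk => by
      by_contra h
      exact hk (by simp [show X k = 0 by simpa using h])),
    finsum_eq_sum_of_support_subset (s := hX.toFinset) _ (fun k hk => by
      by_contra h
      exact hk (by simp [show X k = 0 by simpa using h]))]
  have hP : ∀ k, 0 ≤ (k.factorial : ℝ) ^ (1 / 2 : ℝ) * projectivePower B.seminorm k (X k) :=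
    fun k => mul_nonneg (by positivity) (apply_nonneg _ _)
  rw [Real.sqrt_le_left (Finset.sum_nonneg fun k _ => hP k)]
  refine le_trans (Finset.sum_le_sum fun k _ => ?_)
    (Finset.sum_sq_le_sq_sum_of_nonneg fun k _ => hP k)
  rw [mul_pow, ← Real.sqrt_eq_rpow, Real.sq_sqrt (by positivity)]
  exact mul_le_mul_of_nonneg_left
    (pow_le_pow_left₀ (apply_nonneg _ _) (B.power_seminorm_le k (X k)) 2) (by positivity)

theorem PosHermForm.power_seminorm_le_tens (B : PosHermForm V) (X : Tens V) (k : ℕ) :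
    (k.factorial : ℝ) ^ (1 / 2 : ℝ) * (B.power k).seminorm (X k) ≤ B.tens.seminorm X := by
  rw [seminorm_apply B.tens, tens_form_self]
  refine Real.le_sqrt_of_sq_le ?_
  rw [mul_pow, ← Real.sqrt_eq_rpow, Real.sq_sqrt (by positivity)]
  refine single_le_finsum (f := fun k => (k.factorial : ℝ) * (B.power k).seminorm (X k) ^ 2) k
    ((DFinsupp.finite_support X).subset fun k hk hX => hk ?_)
    fun k => by positivity
  change X k = 0 at hX
  simp [hX]

/-- Each weighted degree is bounded by the whole Hilbert seminorm, so the sum over degrees costs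
only `∑ₖ 2^{-k} = 2`. -/
theorem projectiveTens_le_of_projectivePower_le {p : Seminorm ℂ V} {B : PosHermForm V}
    (h : ∀ k X, projectivePower p k X ≤ (1 / 2 : ℝ) ^ k * (B.power k).seminorm X) (X : Tens V) :
    projectiveTens (1 / 2) p X ≤ 2 * B.tens.seminorm X := by
  rw [projectiveTens_apply,
    finsum_eq_sum_of_support_subset (s := (finite_support_projective (1 / 2) p X).toFinset) _
      (by simp)]
  refine (Finset.sum_le_sum fun k _ => ?_).trans (?_ :
    ∑ k ∈ (finite_support_projective (1 / 2) p X).toFinset,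
      (1 / 2 : ℝ) ^ k * B.tens.seminorm X ≤ _)
  · refine (mul_le_mul_of_nonneg_left (h k (X k)) (by positivity)).trans ?_
    rw [mul_left_comm]
    exact mul_le_mul_of_nonneg_left (B.power_seminorm_le_tens X k) (by positivity)
  · rw [← Finset.sum_mul]
    exact mul_le_mul_of_nonneg_right
      ((summable_geometric_two.sum_le_tsum _ fun n _ => by positivity).trans_eq
        tsum_geometric_two) (apply_nonneg _ _)

/-! ### Finite-rank approximation in tensor powers and the nuclear estimate -/

theorem tendsto_projectivePower_sub_map {p : Seminorm ℂ V} {F : ℕ → V →ₗ[ℂ] V}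
    (hF : ∀ x, Tendsto (fun j => p (x - F j x)) atTop (𝓝 0)) {k : ℕ} (X : ⨂[ℂ]^k V) :
    Tendsto (fun j => projectivePower p k (X - PiTensorProduct.map (fun _ => F j) X))
      atTop (𝓝 0) := by
  induction X using PiTensorProduct.induction_on with
  | add a b ha hb =>
    have hab := ha.add hb
    rw [add_zero] at hab
    refine squeeze_zero (fun j => apply_nonneg _ _) (fun j => ?_) hab
    rw [map_add, add_sub_add_comm]
    exact map_add_le_add _ _ _
  | smul_tprod c x =>
    have hx : Tendsto (fun j => projectivePower p k (PiTensorProduct.tprod ℂ x -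
        PiTensorProduct.map (fun _ => F j) (PiTensorProduct.tprod ℂ x))) atTop (𝓝 0) := by
      -- Read between the seminormed spaces of `p` and `p^{⊗k}`, the map `⊗` is a multilinear map of
      -- bound `1`, hence continuous; this replaces a telescoping argument.
      let T : MultilinearMap ℂ (fun _ : Fin k => SeminormSpace p)
          (SeminormSpace (projectivePower p k)) :=
        (PiTensorProduct.tprod ℂ : MultilinearMap ℂ (fun _ : Fin k => V) (⨂[ℂ]^k V))
      have hT : Continuous T := T.continuous_of_bound 1 fun m =>
        (projectivePower_tprod_le p m).trans_eq (one_mul _).symm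
      have hFx : Tendsto (β := Fin k → SeminormSpace p) (fun j m => F j (x m)) atTop
          (𝓝 x) := by
        refine (tendsto_pi_nhds (A := fun _ : Fin k => SeminormSpace p)).2 fun m =>
          (tendsto_iff_norm_sub_tendsto_zero (E := SeminormSpace p)).2 ?_
        refine (hF (x m)).congr fun j => ?_
        exact map_sub_rev p (x m) (F j (x m))
      refine (tendsto_iff_norm_sub_tendsto_zero.1 ((hT.tendsto _).comp hFx)).congr fun j => ?_
      rw [PiTensorProduct.map_tprod]
      exact map_sub_rev (projectivePower p k) _ _
    have hc := hx.const_mul ‖c‖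
    rw [mul_zero] at hc
    refine hc.congr fun j => ?_
    rw [map_smul, ← smul_sub, map_smul_eq_mul]

open Fintype in
-- Writes the image of `X` under a finite-rank operator as an explicit finite sum of elementary
-- tensors, the form in which `p^{⊗k}` can be bounded.
theorem map_sum_smulRight_eq (g : ℕ → V →ₗ[ℂ] ℂ) (z : ℕ → V) (N : ℕ) {k : ℕ} (X : ⨂[ℂ]^k V) :
    PiTensorProduct.map (fun _ => ∑ n ∈ Finset.range N, (g n).smulRight (z n)) X =
      ∑ r ∈ piFinset fun _ : Fin k => Finset.range N,
        prodFunctional (fun m => g (r m)) X • PiTensorProduct.tprod ℂ fun m => z (r m) := by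
  induction X using PiTensorProduct.induction_on with
  | add a b ha hb => simp only [map_add, add_smul, Finset.sum_add_distrib, ha, hb]
  | smul_tprod c x =>
    simp only [map_smul, smul_assoc, ← Finset.smul_sum, PiTensorProduct.map_tprod,
      prodFunctional_tprod]
    congr 1
    simp only [LinearMap.sum_apply, LinearMap.smulRight_apply, MultilinearMap.map_sum_finset,
      MultilinearMap.map_smul_univ]

open Fintype in
/-- In a nuclear space, the projective tensor powers of a continuous seminorm are dominated by the
tensor powers of a continuous Hilbert seminorm. -/
theorem IsNuclearSpace.exists_projectivePower_le [TopologicalSpace V] (hV : IsNuclearSpace V)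
    {p : Seminorm ℂ V} (hp : Continuous p) :
    ∃ B : ContPosHermForm V, ∀ k X,
      projectivePower p k X ≤ (1 / 2 : ℝ) ^ k * (B.1.power k).seminorm X := by
  have := hV.locallyConvex
  have : IsTopologicalAddGroup V := (PolynormableSpace.withSeminorms ℂ V).topologicalAddGroup
  obtain ⟨q, hpq, hq, hn⟩ := hV.exists_nuclear p hp
  obtain ⟨g, s, z, hs0, hs, hg, hz, hlim⟩ := hn.exists_finite_rank_approx
  have hC : 0 < ∑' n, s n := hs.tsum_pos (fun n => (hs0 n).le) 0 (hs0 0)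
  set C := ∑' n, s n
  -- The weight `4C sₙ` is chosen so that the complementary weights `sₙ/(4C)` sum to `1/4`, whose
  -- `k`-th power has square root `2^{-k}`.
  have ht0 : ∀ n, 0 ≤ 4 * C * s n := fun n => by have := hs0 n; positivity
  have ht : Summable fun n => 4 * C * s n := hs.mul_left _
  refine ⟨⟨.ofFunctionals g _ q ht ht0 hg,
    PosHermForm.continuous_of_norm_le _ hq (PosHermForm.norm_ofFunctionals_le ht ht0 hg)⟩,
    fun k X => ?_⟩
  let F : ℕ → V →ₗ[ℂ] V := fun j => ∑ n ∈ Finset.range j, (g n).smulRight (z j n)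
  have hF : ∀ x, Tendsto (fun j => p (x - F j x)) atTop (𝓝 0) := fun x =>
    (hlim x).congr fun j => by simp [F]
  have hlimX := (tendsto_projectivePower_sub_map hF X).add_const
    ((1 / 2 : ℝ) ^ k * ((PosHermForm.ofFunctionals g _ q ht ht0 hg).power k).seminorm X)
  rw [zero_add] at hlimX
  -- It suffices to bound the finite-rank image of `X` with a constant independent of `j`; the
  -- remainder tends to `0`.
  refine ge_of_tendsto' hlimX fun j => ?_
  have hsplit := map_add_le_add (projectivePower p k)
    (X - PiTensorProduct.map (fun _ => F j) X) (PiTensorProduct.map (fun _ => F j) X)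
  rw [sub_add_cancel] at hsplit
  refine hsplit.trans (add_le_add le_rfl ?_)
  rw [map_sum_smulRight_eq]
  let I := piFinset fun _ : Fin k => Finset.range j
  have hs' : ∀ r : Fin k → ℕ, 0 ≤ ∏ m, s (r m) := fun r =>
    Finset.prod_nonneg fun m _ => (hs0 _).le
  have ht' : ∀ r : Fin k → ℕ, 0 < ∏ m, (4 * C * s (r m)) := fun r =>
    Finset.prod_pos fun m _ => by have := hs0 (r m); positivity
  have hw : ∑ r ∈ I, ∏ m, s (r m) / (4 * C) ≤ ((1 / 2 : ℝ) ^ k) ^ 2 := by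
    have h1 : ∑ n ∈ Finset.range j, s n / (4 * C) ≤ 1 / 4 := by
      rw [← Finset.sum_div, div_le_iff₀ (by positivity)]
      linarith [hs.sum_le_tsum (Finset.range j) fun n _ => (hs0 n).le]
    rw [show ∑ r ∈ I, ∏ m, s (r m) / (4 * C) =
          ∏ _m : Fin k, ∑ n ∈ Finset.range j, s n / (4 * C) from
          (Finset.prod_univ_sum (fun _ => Finset.range j) fun _ n => s n / (4 * C)).symm,
      Finset.prod_const, Finset.card_univ, Fintype.card_fin,
      ← pow_mul, mul_comm k, pow_mul]
    refine pow_le_pow_left₀ (Finset.sum_nonneg fun n _ => ?_) (h1.trans (by norm_num)) k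
    exact div_nonneg (hs0 n).le (by positivity)
  calc projectivePower p k (∑ r ∈ I, prodFunctional (fun m => g (r m)) X •
          PiTensorProduct.tprod ℂ fun m => z j (r m))
      ≤ ∑ r ∈ I, ‖prodFunctional (fun m => g (r m)) X‖ * ∏ m, p (z j (r m)) :=
        projectivePower_sum_tprod_le p I _ _
    _ ≤ ∑ r ∈ I, (√(∏ m, s (r m) / (4 * C))) *
          (√(∏ m, (4 * C * s (r m))) * ‖prodFunctional (fun m => g (r m)) X‖) := by
        refine Finset.sum_le_sum fun r _ => ?_
        have e : √(∏ m, s (r m) / (4 * C)) * √(∏ m, (4 * C * s (r m))) = ∏ m, s (r m) := by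
          rw [← Real.sqrt_mul' _ (ht' r).le, ← Finset.prod_mul_distrib,
            ← Real.sqrt_sq (hs' r), ← Finset.prod_pow]
          congr 1
          refine Finset.prod_congr rfl fun m _ => ?_
          field_simp
        rw [← mul_assoc, e, mul_comm]
        exact mul_le_mul_of_nonneg_right
          (Finset.prod_le_prod (fun m _ => apply_nonneg p _) fun m _ => hz j _) (norm_nonneg _)
    _ ≤ √(∑ r ∈ I, √(∏ m, s (r m) / (4 * C)) ^ 2) *
          √(∑ r ∈ I, (√(∏ m, (4 * C * s (r m))) *
            -- Cauchy–Schwarz over multi-indices: the first factor is controlled by `hw`, the second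
            -- by the Bessel-type inequality.
            ‖prodFunctional (fun m => g (r m)) X‖) ^ 2) := Real.sum_mul_le_sqrt_mul_sqrt _ _ _
    _ ≤ (1 / 2 : ℝ) ^ k * ((PosHermForm.ofFunctionals g _ q ht ht0 hg).power k).seminorm X := by
        refine mul_le_mul ?_ (Real.sqrt_le_sqrt ?_) (Real.sqrt_nonneg _) (by positivity)
        · refine (Real.sqrt_le_left (by positivity)).2 (le_trans (le_of_eq ?_) hw)
          exact Finset.sum_congr rfl fun r _ => Real.sq_sqrt
            (Finset.prod_nonneg fun m _ => div_nonneg (hs0 _).le (by positivity))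
        · refine le_trans (le_of_eq ?_)
            (PosHermForm.sum_le_powerForm_ofFunctionals ht ht0 hg X j)
          refine Finset.sum_congr rfl fun r _ => ?_
          rw [mul_pow, Real.sq_sqrt (ht' r).le]

/-! ### Comparison of topologies -/

/-- The topology of a seminorm family is finer than that of another one if every seminorm of the
latter is dominated by a multiple of a seminorm of the former. -/
theorem topology_le_of_forall_exists_le {E ι ι' : Type*} [AddCommGroup E] [Module ℂ E]
    (p : SeminormFamily ℂ E ι) (q : SeminormFamily ℂ E ι')
    (h : ∀ i, ∃ (j : ι) (C : NNReal), ∀ x, q i x ≤ C * p j x) :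
    p.moduleFilterBasis.topology ≤ q.moduleFilterBasis.topology := by
  refine continuous_id_iff_le.1 (WithSeminorms.continuous_of_isBounded (p := p) (q := q)
    (.mk (topology := _) rfl) (.mk (topology := _) rfl) LinearMap.id fun i => ?_)
  obtain ⟨j, C, hC⟩ := h i
  exact ⟨{j}, C, fun x => by simpa [NNReal.smul_def] using hC x⟩

theorem PosHermForm.continuous_seminorm [TopologicalSpace V] (B : ContPosHermForm V) :
    Continuous B.1.seminorm :=
  Real.continuous_sqrt.comp (Complex.continuous_re.comp
    (B.2.comp (continuous_id.prodMk continuous_id)))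

end NuclearWeyl

end

/-- For a nuclear space `V`, the topology on the symmetric tensors defined by the extensions of
the continuous Hilbert seminorms is the projective topology with parameter `R = 1/2`; it does not
matter whether the latter is built from all continuous seminorms of `V` or from the continuous
Hilbert seminorms only. -/
theorem proposition4p5 {V : Type*} [AddCommGroup V] [Module ℂ V] [TopologicalSpace V]
    (hV : NuclearWeyl.IsNuclearSpace V) :
    NuclearWeyl.symHilbertTopology V = NuclearWeyl.symProjectiveTopology V (1 / 2) ∧
      NuclearWeyl.symHilbertTopology V =
        NuclearWeyl.symProjectiveTopologyOf (1 / 2) (NuclearWeyl.hilbertSeminorms V) := by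
  open NuclearWeyl in
  have hub : ∀ p : Seminorm ℂ V, Continuous p → ∃ (B : ContPosHermForm V) (C : NNReal),
      ∀ X, projectiveTens (1 / 2) p X ≤ C * B.1.tens.seminorm X := fun p hp =>
    (hV.exists_projectivePower_le hp).imp fun B hB =>
      ⟨2, projectiveTens_le_of_projectivePower_le hB⟩
  have hlb : ∀ (B : ContPosHermForm V) (X : Tens V),
      B.1.tens.seminorm X ≤ (1 : NNReal) * projectiveTens (1 / 2) B.1.seminorm X := fun B X => by
    simpa using B.1.tens_seminorm_le X
  -- All the topologies are induced from `⨁ₖ V^{⊗k}`, and already agree there.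
  refine ⟨congrArg (TopologicalSpace.induced Subtype.val) (le_antisymm ?_ ?_),
    congrArg (TopologicalSpace.induced Subtype.val) (le_antisymm ?_ ?_)⟩
  · exact topology_le_of_forall_exists_le _ _ fun p => hub p.1 p.2
  · exact topology_le_of_forall_exists_le _ _ fun B =>
      ⟨⟨B.1.seminorm, PosHermForm.continuous_seminorm B⟩, 1, hlb B⟩
  · refine topology_le_of_forall_exists_le _ _ ?_
    rintro ⟨_, B, rfl⟩
    exact hub _ (PosHermForm.continuous_seminorm B)
  · exact topology_le_of_forall_exists_le _ _ fun B => ⟨⟨_, B, rfl⟩, 1, hlb B⟩
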